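/- All graphs are finite and simple. A graph is \emph{triangle-covered} if each of its vertices belongs to a triangle. For $r\in\{0,1,2\}$ let $\epsilon_r=\frac{r(5-r)}{2}$, so $\epsilon_0=0$, $\epsilon_1=2$, $\epsilon_2=3$. A connected triangle-covered graph on $n=3q+r$ vertices, $0\le r<3$, is an \emph{extremal triangle-covered graph} if it has exactly $4q-1+\epsilon_r$ edges. Let $H_1$ be two triangles sharing exactly one vertex (5 vertices, 6 edges), $H_2$ two triangles sharing exactly one edge (that is, $K_4$ minus an edge), $H_3$ three triangles sharing one common vertex and otherwise disjoint (7 vertices, 9 edges), and $H_4$ the graph obtained from a triangle by attaching two further triangles, otherwise disjoint, at two distinct vertices of it (7 vertices, 9 edges). Let $\mathcal{G}_{tree}(n)$ be the family of graphs $G$ on $n$ vertices for which there are an $m\ge 1$, a tree $T$ with vertex set $[m]=\{1,\dots,m\}$ and pairwise disjoint sets (bags) $V_i\subseteq V(G)$, $i\in[m]$, such that: 1. $V(G)=\bigcup_{i\in[m]}V_i$. 2. Exactly one of the following occurs: (A) for every $i\in[m]$ the induced subgraph $G[V_i]$ is isomorphic to $H_1$ or $K_3$, and at most two bags are isomorphic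 to $H_1$; (B) there is $j\in[m]$ such that $G[V_i]$ is isomorphic to $K_3$ for every $i\ne j$, and $G[V_j]$ is isomorphic to $H_2$, $H_3$ or $H_4$. 3. For every edge $uv\in E(G)$ exactly one of the following occurs: there is $i\in[m]$ with $u,v\in V_i$; or there are unique $i\neq j\in[m]$ with $u\in V_i$, $v\in V_j$ and $ij\in E(T)$. 4. For every edge $ij\in E(T)$ there is exactly one edge of $G$ between $V_i$ and $V_j$. **Theorem.** Let $G$ be a connected graph on $n\ge 8$ vertices. Then $G$ is an extremal triangle-covered graph if and only if $G\in\mathcal{G}_{tree}(n)$. -/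

import Mathlib

namespace TriangleCovered

/-- Every vertex lies in a triangle. -/
def IsTriangleCovered {V : Type*} (G : SimpleGraph V) : Prop :=
  ∀ v : V, ∃ s : Finset V, G.IsNClique 3 s ∧ v ∈ s

/-- `ε_r = r (5 - r) / 2`, used for `0 ≤ r < 3` only; there the subtraction and the division
are exact and the values are `0, 2, 3`. -/
def eps (r : ℕ) : ℕ := r * (5 - r) / 2

/-- Extremal triangle-covered graphs: connected and triangle-covered on `n = 3 q + r` vertices
(`0 ≤ r < 3`), with exactly `4 q - 1 + ε_r` edges. -/
def IsExtremal {V : Type*} [Fintype V] (G : SimpleGraph V) : Prop :=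
  G.Connected ∧ IsTriangleCovered G ∧
    ∃ q r : ℕ, Fintype.card V = 3 * q + r ∧ r < 3 ∧
      (G.edgeSet.ncard : ℤ) = 4 * (q : ℤ) - 1 + (eps r : ℤ)

/-- The triangle `K₃`. -/
def K3 : SimpleGraph (Fin 3) := ⊤

/-- `H₁`: two triangles sharing exactly one vertex (order 5, size 6). -/
def H1 : SimpleGraph (Fin 5) :=
  SimpleGraph.fromEdgeSet {s(0, 1), s(0, 2), s(1, 2), s(0, 3), s(0, 4), s(3, 4)}

/-- `H₂`: two triangles sharing exactly one edge, i.e. `K₄` minus an edge (order 4, size 5). -/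
def H2 : SimpleGraph (Fin 4) :=
  SimpleGraph.fromEdgeSet {s(0, 1), s(0, 2), s(1, 2), s(0, 3), s(1, 3)}

/-- `H₃`: three triangles sharing one common vertex (order 7, size 9). -/
def H3 : SimpleGraph (Fin 7) :=
  SimpleGraph.fromEdgeSet
    {s(0, 1), s(0, 2), s(1, 2), s(0, 3), s(0, 4), s(3, 4), s(0, 5), s(0, 6), s(5, 6)}

/-- `H₄`: a triangle `012` with two further triangles attached at two distinct vertices of it
(order 7, size 9). -/
def H4 : SimpleGraph (Fin 7) :=
  SimpleGraph.fromEdgeSet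
    {s(0, 1), s(0, 2), s(1, 2), s(0, 3), s(0, 4), s(3, 4), s(1, 5), s(1, 6), s(5, 6)}

/-- The subgraph of `G` induced by the vertex set `S` is isomorphic to `H`. -/
def InducedIso {V W : Type*} (G : SimpleGraph V) (S : Set V) (H : SimpleGraph W) : Prop :=
  Nonempty (G.induce S ≃g H)

/-- `T` (a tree on `m` vertices) and the bags `B i` form a tree-like bag decomposition of `G`. -/
structure IsBagDecomposition {V : Type*} (G : SimpleGraph V) {m : ℕ}
    (T : SimpleGraph (Fin m)) (B : Fin m → Set V) : Prop where
  isTree : T.IsTree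
  disjoint : ∀ i j : Fin m, i ≠ j → Disjoint (B i) (B j)
  cover : (⋃ i, B i) = Set.univ
  /-- The admissible shapes of the bags. -/
  shape : Xor
    ((∀ i, InducedIso G (B i) H1 ∨ InducedIso G (B i) K3) ∧
      {i | InducedIso G (B i) H1}.ncard ≤ 2)
    (∃ j, (∀ i, i ≠ j → InducedIso G (B i) K3) ∧
      (InducedIso G (B j) H2 ∨ InducedIso G (B j) H3 ∨ InducedIso G (B j) H4))
  /-- Every edge of `G` lies inside a bag or joins two bags that are adjacent in `T`. -/
  edge : ∀ u v : V, G.Adj u v → Xor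
    (∃ i, u ∈ B i ∧ v ∈ B i)
    (∃! p : Fin m × Fin m, p.1 ≠ p.2 ∧ u ∈ B p.1 ∧ v ∈ B p.2 ∧ T.Adj p.1 p.2)
  /-- Every edge of `T` is realised by exactly one edge of `G`. -/
  link : ∀ i j : Fin m, T.Adj i j → ∃! e : V × V, e.1 ∈ B i ∧ e.2 ∈ B j ∧ G.Adj e.1 e.2

/-- Membership of `G` in the family `𝒢_tree(n)`. -/
def MemGTree {V : Type*} [Fintype V] (n : ℕ) (G : SimpleGraph V) : Prop :=
  Fintype.card V = n ∧
    ∃ (m : ℕ) (T : SimpleGraph (Fin m)) (B : Fin m → Set V), IsBagDecomposition G T B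

end TriangleCovered

namespace TriangleCovered

/-! The prescribed edge count says exactly that `4n ≤ 3e + 3 ≤ 4n + 2` (`isExtremal_iff`). The
natural bags are the components of the graph of edges lying in triangles. In a triangle-covered
graph each bag has `k ≥ 3` vertices, and growing it triangle by triangle costs at least `3/2` edges
per new vertex, so `2e ≥ 3(k - 1)` inside the bag (`TriangleConnected.growth_bound`). Hence its
excess `3e + 3 - 4k` is at least `(k - 3)/2`, so nonnegative.

Summing over `m` bags gives `3e(G) + 3 = 4n + ∑ excess + 3(c - (m - 1))`, with `c` the number of
edges between bags (`sum_excess`). If `G` is connected then so is the quotient, and `c ≥ m - 1`.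
Extremality therefore means that `c = m - 1`, so the quotient is a tree with each edge realised
once, and that the total excess is at most 2. Excess 0, 1, 2 forces `K3`, `H1`, and one of `H2`,
`H3`, `H4` (`inducedIso_of_excess`). Conversely, these shapes have those excesses, so the same
identity returns the edge count. -/

/-- Every nonempty proper vertex set is left by an edge of some triangle. -/
def TriangleConnected {W : Type*} (K : SimpleGraph W) : Prop :=
  ∀ S : Set W, S.Nonempty → S ≠ Set.univ →
    ∃ a ∈ S, ∃ b ∉ S, ∃ c, K.Adj a b ∧ K.Adj a c ∧ K.Adj b c

/-- The edges with both ends in `S`. -/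
def edgesIn {W : Type*} (K : SimpleGraph W) (S : Set W) : Set (Sym2 W) :=
  {e ∈ K.edgeSet | ∀ x ∈ e, x ∈ S}

/-! ### Edge bound by growing along triangles, and its equality case. -/

section Growth

variable {W : Type*} {K : SimpleGraph W}

lemma mk_mem_edgesIn {S : Set W} {u v : W} :
    s(u, v) ∈ edgesIn K S ↔ K.Adj u v ∧ u ∈ S ∧ v ∈ S := by
  simp [edgesIn]

lemma edgesIn_mono {S S' : Set W} (h : S ⊆ S') : edgesIn K S ⊆ edgesIn K S' :=
  fun _ he => ⟨he.1, fun x hx => h (he.2 x hx)⟩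

lemma edgesIn_singleton (v : W) : edgesIn K {v} = ∅ := by
  ext e
  induction e with
  | h x y =>
    simp only [mk_mem_edgesIn, Set.mem_singleton_iff, Set.mem_empty_iff_false, iff_false]
    rintro ⟨h, rfl, rfl⟩
    exact h.ne rfl

lemma ne_univ_of_ncard_lt {S : Set W} (h : S.ncard < Nat.card W) : S ≠ Set.univ := by
  rintro rfl
  rw [Set.ncard_univ] at h
  exact lt_irrefl _ h

variable [Finite W]

lemma ncard_edgesIn_add_three_le {S : Set W} {a b c : W} (ha : a ∈ S) (hb : b ∉ S) (hc : c ∉ S)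
    (hab : K.Adj a b) (hac : K.Adj a c) (hbc : K.Adj b c) :
    (edgesIn K S).ncard + 3 ≤ (edgesIn K (insert b (insert c S))).ncard := by
  have hne : a ≠ c := hac.ne
  have hne' : a ≠ b := hab.ne
  have hne'' : b ≠ c := hbc.ne
  have h1 : s(b, c) ∉ edgesIn K S := by simp [mk_mem_edgesIn, hb]
  have h2 : s(a, c) ∉ insert s(b, c) (edgesIn K S) := by
    simp [mk_mem_edgesIn, hc, hne, hne']
  have h3 : s(a, b) ∉ insert s(a, c) (insert s(b, c) (edgesIn K S)) := by
    simp [mk_mem_edgesIn, hb, hne, hne', hne'']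
  calc (edgesIn K S).ncard + 3
      = (insert s(a, b) (insert s(a, c) (insert s(b, c) (edgesIn K S)))).ncard := by
        rw [Set.ncard_insert_of_notMem h3, Set.ncard_insert_of_notMem h2,
          Set.ncard_insert_of_notMem h1]
    _ ≤ _ := by
        refine Set.ncard_le_ncard ?_
        rintro e (rfl | rfl | rfl | he)
        · simp [mk_mem_edgesIn, *]
        · simp [mk_mem_edgesIn, *]
        · simp [mk_mem_edgesIn, *]
        · exact edgesIn_mono (fun x hx => by simp [hx]) he

lemma ncard_edgesIn_add_two_le {S : Set W} {a b c : W} (ha : a ∈ S) (hb : b ∉ S) (hc : c ∈ S)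
    (hab : K.Adj a b) (hac : K.Adj a c) (hbc : K.Adj b c) :
    (edgesIn K S).ncard + 2 ≤ (edgesIn K (insert b S)).ncard := by
  have hne : a ≠ c := hac.ne
  have hne' : a ≠ b := hab.ne
  have h1 : s(b, c) ∉ edgesIn K S := by simp [mk_mem_edgesIn, hb]
  have h2 : s(a, b) ∉ insert s(b, c) (edgesIn K S) := by
    simp [mk_mem_edgesIn, hb, hne, hne']
  calc (edgesIn K S).ncard + 2
      = (insert s(a, b) (insert s(b, c) (edgesIn K S))).ncard := by
        rw [Set.ncard_insert_of_notMem h2, Set.ncard_insert_of_notMem h1]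
    _ ≤ _ := by
        refine Set.ncard_le_ncard ?_
        rintro e (rfl | rfl | he)
        · simp [mk_mem_edgesIn, *]
        · simp [mk_mem_edgesIn, *]
        · exact edgesIn_mono (fun x hx => by simp [hx]) he

lemma ncard_insert_insert {S : Set W} {b c : W} (hb : b ∉ S) (hc : c ∉ S) (hbc : b ≠ c) :
    (insert b (insert c S)).ncard = S.ncard + 2 := by
  rw [Set.ncard_insert_of_notMem (by simp [hb, hbc]), Set.ncard_insert_of_notMem hc]

/-- Absorbing a triangle that leaves `S` adds one vertex and at least two edges, or two vertices and
at least three edges. Either way `2 * edges - 3 * vertices` does not decrease until everything is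
absorbed. -/
lemma TriangleConnected.growth_bound (hK : TriangleConnected K) (S : Set W) (hS : S.Nonempty) :
    3 * Nat.card W + 2 * (edgesIn K S).ncard ≤ 2 * K.edgeSet.ncard + 3 * S.ncard := by
  induction hk : Sᶜ.ncard using Nat.strong_induction_on generalizing S with
  | _ k ih =>
    have hcompl := fun S : Set W => Set.ncard_add_ncard_compl S
    by_cases huniv : S = Set.univ
    · subst huniv
      have : (edgesIn K Set.univ).ncard ≤ K.edgeSet.ncard :=
        Set.ncard_le_ncard fun e he => he.1
      rw [Set.ncard_univ]
      omega
    obtain ⟨a, ha, b, hb, c, hab, hac, hbc⟩ := hK S hS huniv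
    by_cases hc : c ∈ S
    · have h1 := ncard_edgesIn_add_two_le ha hb hc hab hac hbc
      have h2 := Set.ncard_insert_of_notMem hb
      have h3 := hcompl S
      have h4 := hcompl (insert b S)
      have := ih _ (by omega) (insert b S) (Set.insert_nonempty _ _) rfl
      omega
    · have h1 := ncard_edgesIn_add_three_le ha hb hc hab hac hbc
      have h2 := ncard_insert_insert hb hc hbc.ne
      have h3 := hcompl S
      have h4 := hcompl (insert b (insert c S))
      have := ih _ (by omega) (insert b (insert c S)) (Set.insert_nonempty _ _) rfl
      omega

lemma TriangleConnected.three_mul_card_le [Nonempty W] (hK : TriangleConnected K) :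
    3 * Nat.card W ≤ 2 * K.edgeSet.ncard + 3 := by
  obtain ⟨v⟩ := ‹Nonempty W›
  have := hK.growth_bound {v} (Set.singleton_nonempty v)
  rw [edgesIn_singleton, Set.ncard_empty, Set.ncard_singleton] at this
  omega

/-- Equality in the growth bound for `S`. -/
def IsTight {W : Type*} (K : SimpleGraph W) (S : Set W) : Prop :=
  3 * Nat.card W + 2 * (edgesIn K S).ncard = 2 * K.edgeSet.ncard + 3 * S.ncard

/-- From a tight set, a one-vertex step would gain 4 against 3 and break the growth bound for the
larger set. So the leaving triangle has two new vertices, and there is no slack to lose. -/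
lemma TriangleConnected.exists_tight_insert (hK : TriangleConnected K) {S : Set W}
    (hS : S.Nonempty) (huniv : S ≠ Set.univ) (ht : IsTight K S) :
    ∃ a ∈ S, ∃ b ∉ S, ∃ c ∉ S, K.Adj a b ∧ K.Adj a c ∧ K.Adj b c ∧
      IsTight K (insert b (insert c S)) := by
  obtain ⟨a, ha, b, hb, c, hab, hac, hbc⟩ := hK S hS huniv
  unfold IsTight at *
  by_cases hc : c ∈ S
  · have h1 := ncard_edgesIn_add_two_le ha hb hc hab hac hbc
    have h2 := Set.ncard_insert_of_notMem hb
    have := hK.growth_bound (insert b S) (Set.insert_nonempty _ _)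
    omega
  · have h1 := ncard_edgesIn_add_three_le ha hb hc hab hac hbc
    have h2 := ncard_insert_insert hb hc hbc.ne
    have := hK.growth_bound (insert b (insert c S)) (Set.insert_nonempty _ _)
    exact ⟨a, ha, b, hb, c, hc, hab, hac, hbc, by omega⟩

omit [Finite W] in
lemma TriangleConnected.exists_triangle [Nonempty W] (hK : TriangleConnected K)
    (h : 1 < Nat.card W) : ∃ a b c, K.Adj a b ∧ K.Adj a c ∧ K.Adj b c := by
  obtain ⟨v⟩ := ‹Nonempty W›
  obtain ⟨a, -, b, -, c, h⟩ := hK {v} (Set.singleton_nonempty v)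
    (ne_univ_of_ncard_lt (by simpa using h))
  exact ⟨a, b, c, h⟩

/-- A tight graph on at least five vertices contains two triangles `xab` and `xcd` that share
exactly the vertex `x`. -/
lemma TriangleConnected.exists_tight_bowtie [Nonempty W] (hK : TriangleConnected K)
    (hcard : 5 ≤ Nat.card W) (ht : 3 * Nat.card W = 2 * K.edgeSet.ncard + 3) :
    ∃ x a b c d, K.Adj x a ∧ K.Adj x b ∧ K.Adj a b ∧ K.Adj x c ∧ K.Adj x d ∧ K.Adj c d ∧
      a ≠ c ∧ a ≠ d ∧ b ≠ c ∧ b ≠ d ∧ IsTight K {x, a, b, c, d} := by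
  obtain ⟨v⟩ := ‹Nonempty W›
  have ht₀ : IsTight K {v} := by
    simp only [IsTight, edgesIn_singleton, Set.ncard_empty, Set.ncard_singleton]
    omega
  obtain ⟨u, rfl, a, -, b, -, hva, hvb, hab, ht₁⟩ := hK.exists_tight_insert
    (Set.singleton_nonempty v) (ne_univ_of_ncard_lt (by simp; omega)) ht₀
  have hlt : ({a, b, u} : Set W).ncard < Nat.card W := by
    have h1 := Set.ncard_insert_le a {b, u}
    have h2 := Set.ncard_insert_le b {u}
    rw [Set.ncard_singleton] at h2
    omega
  obtain ⟨x, hx, c, hc, d, hd, hxc, hxd, hcd, ht₂⟩ := hK.exists_tight_insert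
    (Set.insert_nonempty _ _) (ne_univ_of_ncard_lt hlt) ht₁
  simp only [Set.mem_insert_iff, Set.mem_singleton_iff, not_or] at hx hc hd
  obtain ⟨hca, hcb, hcv⟩ := hc
  obtain ⟨hda, hdb, hdv⟩ := hd
  -- The second triangle may hang at any vertex of the first; that vertex becomes the centre of the
  -- bowtie.
  rcases hx with rfl | rfl | rfl
  · refine ⟨x, b, _, c, d, hab, hva.symm, hvb.symm, hxc, hxd, hcd, Ne.symm ‹_›, Ne.symm ‹_›,
      Ne.symm hcv, Ne.symm hdv, ?_⟩
    convert! ht₂ using 1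
    ext y; simp; tauto
  · refine ⟨x, a, _, c, d, hab.symm, hvb.symm, hva.symm, hxc, hxd, hcd, Ne.symm ‹_›, Ne.symm ‹_›,
      Ne.symm hcv, Ne.symm hdv, ?_⟩
    convert! ht₂ using 1
    ext y; simp; tauto
  · refine ⟨x, a, b, c, d, hva, hvb, hab, hxc, hxd, hcd, Ne.symm ‹_›, Ne.symm ‹_›,
      Ne.symm ‹_›, Ne.symm ‹_›, ?_⟩
    convert! ht₂ using 1
    ext y; simp; tauto

end Growth

/-! ### Identifying the small triangle-connected graphs. -/

section Classification

variable {W : Type*} [Finite W] {K : SimpleGraph W}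

/-- Finding a copy of the listed edges suffices: the edge count leaves no room for further ones. -/
lemma nonempty_iso_fromEdgeSet {k : ℕ} {s : Set (Sym2 (Fin k))} (f : Fin k → W)
    (hf : f.Injective) (hcard : Nat.card W = k) (hs : ∀ e ∈ s, e.map f ∈ K.edgeSet)
    (hE : K.edgeSet.ncard ≤ (SimpleGraph.fromEdgeSet s).edgeSet.ncard) :
    Nonempty (K ≃g SimpleGraph.fromEdgeSet s) := by
  have hbij : f.Bijective := (Nat.bijective_iff_injective_and_card f).2 ⟨hf, by simp [hcard]⟩
  let φ := Equiv.ofBijective f hbij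
  have hmap : (SimpleGraph.fromEdgeSet s).map φ.toEmbedding = K := by
    rw [← SimpleGraph.edgeSet_inj, SimpleGraph.edgeSet_map]
    refine Set.eq_of_subset_of_ncard_le ?_ ?_
    · rintro _ ⟨e, he, rfl⟩
      rw [SimpleGraph.edgeSet_fromEdgeSet] at he
      exact hs e he.1
    · rwa [Set.ncard_image_of_injective _ (Function.Embedding.injective _)]
  have := SimpleGraph.Iso.map φ (SimpleGraph.fromEdgeSet s)
  exact ⟨hmap ▸ this.symm⟩

lemma ncard_edgeSet_fromEdgeSet {k : ℕ} (s : Finset (Sym2 (Fin k))) :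
    (SimpleGraph.fromEdgeSet (s : Set (Sym2 (Fin k)))).edgeSet.ncard =
      (s.filter fun e => ¬ e.IsDiag).card := by
  rw [SimpleGraph.edgeSet_fromEdgeSet, ← Set.ncard_coe_finset]
  congr 1
  ext e
  simp

lemma ncard_edgeSet_H1 : H1.edgeSet.ncard = 6 := by
  have := ncard_edgeSet_fromEdgeSet
    ({s(0, 1), s(0, 2), s(1, 2), s(0, 3), s(0, 4), s(3, 4)} : Finset (Sym2 (Fin 5)))
  push_cast at this
  rw [H1, this]
  decide

lemma ncard_edgeSet_H2 : H2.edgeSet.ncard = 5 := by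
  have := ncard_edgeSet_fromEdgeSet
    ({s(0, 1), s(0, 2), s(1, 2), s(0, 3), s(1, 3)} : Finset (Sym2 (Fin 4)))
  push_cast at this
  rw [H2, this]
  decide

lemma ncard_edgeSet_H3 : H3.edgeSet.ncard = 9 := by
  have := ncard_edgeSet_fromEdgeSet
    ({s(0, 1), s(0, 2), s(1, 2), s(0, 3), s(0, 4), s(3, 4), s(0, 5), s(0, 6), s(5, 6)} :
      Finset (Sym2 (Fin 7)))
  push_cast at this
  rw [H3, this]
  decide

lemma ncard_edgeSet_H4 : H4.edgeSet.ncard = 9 := by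
  have := ncard_edgeSet_fromEdgeSet
    ({s(0, 1), s(0, 2), s(1, 2), s(0, 3), s(0, 4), s(3, 4), s(1, 5), s(1, 6), s(5, 6)} :
      Finset (Sym2 (Fin 7)))
  push_cast at this
  rw [H4, this]
  decide

lemma K3_eq : K3 = SimpleGraph.fromEdgeSet {s(0, 1), s(0, 2), s(1, 2)} := by
  ext i j
  fin_cases i <;> fin_cases j <;> simp [K3]

lemma ncard_edgeSet_K3 : K3.edgeSet.ncard = 3 := by
  have := ncard_edgeSet_fromEdgeSet ({s(0, 1), s(0, 2), s(1, 2)} : Finset (Sym2 (Fin 3)))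
  push_cast at this
  rw [K3_eq, this]
  decide

lemma nonempty_iso_K3 [Nonempty W] (hK : TriangleConnected K) (hn : Nat.card W = 3)
    (hE : K.edgeSet.ncard = 3) : Nonempty (K ≃g K3) := by
  obtain ⟨a, b, c, hab, hac, hbc⟩ := hK.exists_triangle (by omega)
  rw [K3_eq]
  refine nonempty_iso_fromEdgeSet ![a, b, c] ?_ hn ?_ ?_
  · rw [← List.nodup_ofFn]
    simp [hab.ne, hac.ne, hbc.ne]
  · simp [*]
  · rw [← K3_eq, ncard_edgeSet_K3, hE]

lemma nonempty_iso_H1 [Nonempty W] (hK : TriangleConnected K) (hn : Nat.card W = 5)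
    (hE : K.edgeSet.ncard = 6) : Nonempty (K ≃g H1) := by
  obtain ⟨x, a, b, c, d, hxa, hxb, hab, hxc, hxd, hcd, hac, had, hbc, hbd, -⟩ :=
    hK.exists_tight_bowtie (by omega) (by omega)
  refine nonempty_iso_fromEdgeSet ![x, a, b, c, d] ?_ hn ?_ ?_
  · rw [← List.nodup_ofFn]
    simp [hxa.ne, hxb.ne, hab.ne, hxc.ne, hxd.ne, hcd.ne, *]
  · simp [*]
  · exact hE.trans_le ncard_edgeSet_H1.ge

lemma nonempty_iso_H2_of_adj {a b c d : W} (hn : Nat.card W = 4) (hE : K.edgeSet.ncard = 5)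
    (hab : K.Adj a b) (hac : K.Adj a c) (hbc : K.Adj b c) (had : K.Adj a d) (hbd : K.Adj b d)
    (hcd : c ≠ d) : Nonempty (K ≃g H2) := by
  refine nonempty_iso_fromEdgeSet ![a, b, c, d] ?_ hn ?_ ?_
  · rw [← List.nodup_ofFn]
    simp [hab.ne, hac.ne, hbc.ne, had.ne, hbd.ne, *]
  · simp [*]
  · exact hE.trans_le ncard_edgeSet_H2.ge

/-- Five edges on four vertices is not tight, so the bowtie argument does not apply. Instead, a
second triangle through the fourth vertex must share an edge with the first. -/
lemma nonempty_iso_H2 [Nonempty W] (hK : TriangleConnected K) (hn : Nat.card W = 4)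
    (hE : K.edgeSet.ncard = 5) : Nonempty (K ≃g H2) := by
  obtain ⟨a, b, c, hab, hac, hbc⟩ := hK.exists_triangle (by omega)
  have hS : ({a, b, c} : Set W).ncard = 3 :=
    Set.ncard_eq_three.2 ⟨a, b, c, hab.ne, hac.ne, hbc.ne, rfl⟩
  obtain ⟨x, hx, d, hd, y, hxd, hxy, hdy⟩ := hK {a, b, c} (Set.insert_nonempty _ _)
    (ne_univ_of_ncard_lt (by omega))
  have hy : y ∈ ({a, b, c} : Set W) := by
    by_contra hy
    have h1 := ncard_insert_insert hd hy hdy.ne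
    have h2 := Set.ncard_le_card (insert d (insert y ({a, b, c} : Set W)))
    omega
  simp only [Set.mem_insert_iff, Set.mem_singleton_iff, not_or] at hx hd hy
  obtain ⟨hda, hdb, hdc⟩ := hd
  -- One case for each side of `abc` that can be the shared edge.
  have h1 := fun h h' => nonempty_iso_H2_of_adj (d := d) hn hE hab hac hbc h h' (Ne.symm hdc)
  have h2 := fun h h' => nonempty_iso_H2_of_adj (d := d) hn hE hac hab hbc.symm h h' (Ne.symm hdb)
  have h3 := fun h h' =>
    nonempty_iso_H2_of_adj (d := d) hn hE hbc hab.symm hac.symm h h' (Ne.symm hda)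
  have hyd := hdy.symm
  rcases hx with rfl | rfl | rfl <;> rcases hy with rfl | rfl | rfl <;>
    first
      | exact absurd rfl hxy.ne
      | exact h1 ‹_› ‹_›
      | exact h2 ‹_› ‹_›
      | exact h3 ‹_› ‹_›

/-- The bowtie `xab`, `xcd` together with a triangle `aef`. -/
lemma nonempty_iso_H4_of_adj {x a b c d e f : W} (hn : Nat.card W = 7)
    (hE : K.edgeSet.ncard = 9) (hxa : K.Adj x a) (hxb : K.Adj x b) (hab : K.Adj a b)
    (hxc : K.Adj x c) (hxd : K.Adj x d) (hcd : K.Adj c d)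
    (hac : a ≠ c) (had : a ≠ d) (hbc : b ≠ c) (hbd : b ≠ d)
    (hae : K.Adj a e) (haf : K.Adj a f) (hef : K.Adj e f)
    (he : e ≠ x ∧ e ≠ a ∧ e ≠ b ∧ e ≠ c ∧ e ≠ d) (hf : f ≠ x ∧ f ≠ a ∧ f ≠ b ∧ f ≠ c ∧ f ≠ d) :
    Nonempty (K ≃g H4) := by
  obtain ⟨he1, he2, he3, he4, he5⟩ := he
  obtain ⟨hf1, hf2, hf3, hf4, hf5⟩ := hf
  refine nonempty_iso_fromEdgeSet ![x, a, b, c, d, e, f] ?_ hn ?_ ?_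
  · rw [← List.nodup_ofFn]
    simp [hxa.ne, hxb.ne, hab.ne, hxc.ne, hxd.ne, hcd.ne, hef.ne, Ne.symm, *]
  · simp [*]
  · exact hE.trans_le ncard_edgeSet_H4.ge

/-- Nine edges on seven vertices is tight, so a third triangle with two new vertices hangs on the
bowtie: at its centre for `H3`, at one of the four symmetric outer vertices for `H4`. -/
lemma nonempty_iso_H3_or_H4 [Nonempty W] (hK : TriangleConnected K) (hn : Nat.card W = 7)
    (hE : K.edgeSet.ncard = 9) : Nonempty (K ≃g H3) ∨ Nonempty (K ≃g H4) := by
  obtain ⟨x, a, b, c, d, hxa, hxb, hab, hxc, hxd, hcd, hac, had, hbc, hbd, ht⟩ :=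
    hK.exists_tight_bowtie (by omega) (by omega)
  have hlt : ({x, a, b, c, d} : Set W).ncard < Nat.card W := by
    have h1 := Set.ncard_insert_le x {a, b, c, d}
    have h2 := Set.ncard_insert_le a {b, c, d}
    have h3 := Set.ncard_insert_le b {c, d}
    have h4 := Set.ncard_insert_le c {d}
    rw [Set.ncard_singleton] at h4
    omega
  obtain ⟨y, hy, e, he, f, hf, hye, hyf, hef, -⟩ := hK.exists_tight_insert
    (Set.insert_nonempty _ _) (ne_univ_of_ncard_lt hlt) ht
  simp only [Set.mem_insert_iff, Set.mem_singleton_iff, not_or] at hy he hf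
  rcases hy with rfl | rfl | rfl | rfl | rfl
  · left
    obtain ⟨he1, he2, he3, he4, he5⟩ := he
    obtain ⟨hf1, hf2, hf3, hf4, hf5⟩ := hf
    refine nonempty_iso_fromEdgeSet ![y, a, b, c, d, e, f] ?_ hn ?_ ?_
    · rw [← List.nodup_ofFn]
      simp [hxa.ne, hxb.ne, hab.ne, hxc.ne, hxd.ne, hcd.ne, hef.ne, Ne.symm, *]
    · simp [*]
    · exact hE.trans_le ncard_edgeSet_H3.ge
  · exact .inr <| nonempty_iso_H4_of_adj hn hE hxa hxb hab hxc hxd hcd hac had hbc hbd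
      hye hyf hef he hf
  · exact .inr <| nonempty_iso_H4_of_adj hn hE hxb hxa hab.symm hxc hxd hcd hbc hbd hac had
      hye hyf hef (by tauto) (by tauto)
  · exact .inr <| nonempty_iso_H4_of_adj hn hE hxc hxd hcd hxa hxb hab
      hac.symm hbc.symm had.symm hbd.symm hye hyf hef (by tauto) (by tauto)
  · exact .inr <| nonempty_iso_H4_of_adj hn hE hxd hxc hcd.symm hxa hxb hab
      had.symm hbd.symm hac.symm hbc.symm hye hyf hef (by tauto) (by tauto)

end Classification

/-! ### Triangle covers of the bags. -/

section Triangles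

variable {V W : Type*}

lemma isTriangleCovered_iff {G : SimpleGraph V} :
    IsTriangleCovered G ↔ ∀ v, ∃ a b, G.Adj v a ∧ G.Adj v b ∧ G.Adj a b := by
  classical
  refine forall_congr' fun v => ⟨?_, ?_⟩
  · rintro ⟨s, hs, hv⟩
    obtain ⟨a, b, c, hab, hac, hbc, rfl⟩ := SimpleGraph.is3Clique_iff.1 hs
    simp only [Finset.mem_insert, Finset.mem_singleton] at hv
    rcases hv with rfl | rfl | rfl
    · exact ⟨b, c, hab, hac, hbc⟩
    · exact ⟨a, c, hab.symm, hbc, hac⟩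
    · exact ⟨a, b, hac.symm, hbc.symm, hab⟩
  · rintro ⟨a, b, hva, hvb, hab⟩
    exact ⟨{v, a, b}, SimpleGraph.is3Clique_triple_iff.2 ⟨hva, hvb, hab⟩, by simp⟩

lemma isTriangleCovered_K3 : IsTriangleCovered K3 := by
  rw [isTriangleCovered_iff, K3]
  decide

lemma isTriangleCovered_H1 : IsTriangleCovered H1 := by
  rw [isTriangleCovered_iff]
  simp only [H1, SimpleGraph.fromEdgeSet_adj, Set.mem_insert_iff, Set.mem_singleton_iff]
  decide

lemma isTriangleCovered_H2 : IsTriangleCovered H2 := by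
  rw [isTriangleCovered_iff]
  simp only [H2, SimpleGraph.fromEdgeSet_adj, Set.mem_insert_iff, Set.mem_singleton_iff]
  decide

lemma isTriangleCovered_H3 : IsTriangleCovered H3 := by
  rw [isTriangleCovered_iff]
  simp only [H3, SimpleGraph.fromEdgeSet_adj, Set.mem_insert_iff, Set.mem_singleton_iff]
  decide

lemma isTriangleCovered_H4 : IsTriangleCovered H4 := by
  rw [isTriangleCovered_iff]
  simp only [H4, SimpleGraph.fromEdgeSet_adj, Set.mem_insert_iff, Set.mem_singleton_iff]
  decide

lemma InducedIso.exists_triangle {G : SimpleGraph V} {S : Set V} {H : SimpleGraph W}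
    (h : InducedIso G S H) (hH : IsTriangleCovered H) {v : V} (hv : v ∈ S) :
    ∃ a b, G.Adj v a ∧ G.Adj v b ∧ G.Adj a b := by
  obtain ⟨φ⟩ := h
  obtain ⟨a, b, hva, hvb, hab⟩ := isTriangleCovered_iff.1 hH (φ ⟨v, hv⟩)
  have key : ∀ x y, H.Adj x y → G.Adj (φ.symm x) (φ.symm y) :=
    fun x y hxy => (φ.symm.map_adj_iff.2 hxy :)
  have hφ : φ.symm (φ ⟨v, hv⟩) = ⟨v, hv⟩ := φ.symm_apply_apply _
  have h1 := key _ _ hva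
  have h2 := key _ _ hvb
  rw [hφ] at h1 h2
  exact ⟨_, _, h1, h2, key _ _ hab⟩

end Triangles

/-! ### Counting vertices and edges over the fibres of a map. -/

section Counting

variable {V W : Type*} {G : SimpleGraph V}

lemma ncard_edgeSet_induce (S : Set V) :
    (G.induce S).edgeSet.ncard = (edgesIn G S).ncard := by
  rw [← Set.ncard_image_of_injective _ (Sym2.map.injective Subtype.val_injective)]
  congr 1
  ext e
  induction e with
  | h x y =>
    rw [mk_mem_edgesIn]
    constructor
    · rintro ⟨e, he, hexy⟩
      induction e with
      | h a b =>
        have ha := a.2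
        have hb := b.2
        have hab : G.Adj a b := he
        rw [Sym2.map_mk, Sym2.eq_iff] at hexy
        rcases hexy with ⟨rfl, rfl⟩ | ⟨rfl, rfl⟩
        · exact ⟨hab, ha, hb⟩
        · exact ⟨hab.symm, hb, ha⟩
    · rintro ⟨h, hx, hy⟩
      exact ⟨s(⟨x, hx⟩, ⟨y, hy⟩), h, rfl⟩

lemma InducedIso.ncard_eq {S : Set V} {H : SimpleGraph W} (h : InducedIso G S H) :
    S.ncard = Nat.card W := by
  obtain ⟨φ⟩ := h
  rw [← Nat.card_coe_set_eq, Nat.card_congr φ.toEquiv]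

lemma InducedIso.ncard_edgesIn {S : Set V} {H : SimpleGraph W} (h : InducedIso G S H) :
    (edgesIn G S).ncard = H.edgeSet.ncard := by
  obtain ⟨φ⟩ := h
  rw [← ncard_edgeSet_induce, ← Nat.card_coe_set_eq, Nat.card_congr φ.mapEdgeSet,
    Nat.card_coe_set_eq]

/-- The edges whose ends have different images under `π`. -/
def crossEdges {ι : Type*} (G : SimpleGraph V) (π : V → ι) : Set (Sym2 V) :=
  {e ∈ G.edgeSet | ¬ (e.map π).IsDiag}

lemma mk_mem_crossEdges {ι : Type*} {π : V → ι} {u v : V} :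
    s(u, v) ∈ crossEdges G π ↔ G.Adj u v ∧ π u ≠ π v := by
  simp [crossEdges]

variable [Finite V] {ι : Type*} [Fintype ι]

lemma card_eq_sum_ncard_fiber (π : V → ι) : Nat.card V = ∑ i, (π ⁻¹' {i}).ncard := by
  rw [← finsum_eq_sum_of_fintype, ← Set.ncard_iUnion_of_finite, ← Set.ncard_univ]
  · congr 1
    ext v
    simp
  · exact fun i => Set.toFinite _
  · exact fun i j hij => Set.disjoint_left.2 fun v hi hj => hij (hi.symm.trans hj)

lemma ncard_edgeSet_eq_sum_add (π : V → ι) :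
    G.edgeSet.ncard = ∑ i, (edgesIn G (π ⁻¹' {i})).ncard + (crossEdges G π).ncard := by
  rw [← finsum_eq_sum_of_fintype, ← Set.ncard_iUnion_of_finite, ← Set.ncard_union_eq]
  · congr 1
    ext e
    induction e with
    | h u v =>
      simp only [Set.mem_union, Set.mem_iUnion, mk_mem_edgesIn, mk_mem_crossEdges,
        SimpleGraph.mem_edgeSet, Set.mem_preimage, Set.mem_singleton_iff]
      by_cases h : π u = π v
      · simp [h]
      · simp only [ne_eq, h, not_false_eq_true, and_true]
        tauto
  · rw [Set.disjoint_left]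
    intro e
    induction e with
    | h u v =>
      simp only [Set.mem_iUnion, mk_mem_edgesIn, mk_mem_crossEdges, Set.mem_preimage,
        Set.mem_singleton_iff]
      rintro ⟨i, -, hu, hv⟩ ⟨-, h⟩
      exact h (hu.trans hv.symm)
  · exact fun i => Set.toFinite _
  · intro i j hij
    rw [Function.onFun, Set.disjoint_left]
    intro e
    induction e with
    | h u v =>
      simp only [mk_mem_edgesIn, Set.mem_preimage, Set.mem_singleton_iff]
      rintro ⟨-, hi, -⟩ ⟨-, hj, -⟩
      exact hij (hi.symm.trans hj)

end Counting

/-- In all three residue classes `4q - 1 + ε_r = ⌈4n/3⌉ - 1`; the two inequalities express this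
without division. -/
lemma isExtremal_iff {V : Type*} [Fintype V] {G : SimpleGraph V} :
    IsExtremal G ↔ G.Connected ∧ IsTriangleCovered G ∧
      4 * Fintype.card V ≤ 3 * G.edgeSet.ncard + 3 ∧
      3 * G.edgeSet.ncard + 3 ≤ 4 * Fintype.card V + 2 := by
  refine and_congr_right fun _ => and_congr_right fun _ => ⟨?_, ?_⟩
  · rintro ⟨q, r, hn, hr, he⟩
    interval_cases r <;> simp [eps] at he <;> omega
  · rintro ⟨h1, h2⟩
    refine ⟨Fintype.card V / 3, Fintype.card V % 3, by omega, by omega, ?_⟩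
    have hr : Fintype.card V % 3 < 3 := by omega
    obtain hr | hr | hr : Fintype.card V % 3 = 0 ∨ Fintype.card V % 3 = 1 ∨
      Fintype.card V % 3 = 2 := by omega
    all_goals
      rw [hr]
      norm_num [eps]
      omega

/-! ### From a bag decomposition to the edge count. -/

section Decomposition

variable {V : Type*} {G : SimpleGraph V} {m : ℕ} {T : SimpleGraph (Fin m)}

lemma IsBagDecomposition.exists_fiber {B : Fin m → Set V} (h : IsBagDecomposition G T B) :
    ∃ π : V → Fin m, B = fun i => π ⁻¹' {i} := by
  have hex : ∀ v, ∃ i, v ∈ B i := fun v => Set.mem_iUnion.1 (h.cover ▸ Set.mem_univ v)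
  choose π hπ using hex
  refine ⟨π, funext fun i => Set.ext fun v => ⟨fun hv => ?_, fun hv => ?_⟩⟩
  · by_contra hne
    exact Set.disjoint_left.1 (h.disjoint _ _ hne) (hπ v) hv
  · obtain rfl : π v = i := hv
    exact hπ v

/-- Cross edges correspond bijectively to edges of `T`: existence in `link` gives surjectivity,
uniqueness gives injectivity. A tree has one edge fewer than vertices. -/
lemma IsBagDecomposition.ncard_crossEdges {π : V → Fin m}
    (h : IsBagDecomposition G T fun i => π ⁻¹' {i}) : (crossEdges G π).ncard + 1 = m := by
  have hadj : ∀ u v, G.Adj u v → π u ≠ π v → T.Adj (π u) (π v) := by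
    intro u v huv hne
    rcases h.edge u v huv with ⟨⟨i, hu, hv⟩, -⟩ | ⟨⟨⟨i, j⟩, ⟨-, hu, hv, hij⟩, -⟩, -⟩
    · exact absurd (hu.trans hv.symm) hne
    · obtain rfl : π u = i := hu
      obtain rfl : π v = j := hv
      exact hij
  have himg : Sym2.map π '' crossEdges G π = T.edgeSet := by
    ext e
    induction e with
    | h i j =>
      constructor
      · rintro ⟨e, he, hij⟩
        induction e with
        | h u v =>
          rw [mk_mem_crossEdges] at he
          rw [← hij]
          exact hadj u v he.1 he.2
      · intro hij
        obtain ⟨⟨u, v⟩, ⟨rfl, rfl, huv⟩, -⟩ := h.link i j hij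
        exact ⟨s(u, v), mk_mem_crossEdges.2 ⟨huv, hij.ne⟩, rfl⟩
  have hinj : Set.InjOn (Sym2.map π) (crossEdges G π) := by
    have key : ∀ u v u' v', G.Adj u v → G.Adj u' v' → π u ≠ π v → π u' = π u → π v' = π v →
        s(u, v) = s(u', v') := by
      intro u v u' v' huv huv' hne h1 h2
      have := (h.link _ _ (hadj u v huv hne)).unique (y₁ := (u, v)) (y₂ := (u', v'))
        ⟨rfl, rfl, huv⟩ ⟨h1, h2, huv'⟩
      rw [Prod.mk.injEq] at this
      rw [this.1, this.2]
    intro e he e' he' heq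
    induction e with
    | h u v =>
      induction e' with
      | h u' v' =>
        rw [mk_mem_crossEdges] at he he'
        rw [Sym2.map_mk, Sym2.map_mk, Sym2.eq_iff] at heq
        rcases heq with ⟨h1, h2⟩ | ⟨h1, h2⟩
        · exact key _ _ _ _ he.1 he'.1 he.2 h1.symm h2.symm
        · rw [key _ _ _ _ he.1 he'.1.symm he.2 h1.symm h2.symm, Sym2.eq_swap]
  rw [← hinj.ncard_image, himg, ← Nat.card_coe_set_eq,
    (SimpleGraph.isTree_iff_connected_and_card.1 h.isTree).2, Nat.card_fin]

lemma IsBagDecomposition.isTriangleCovered {B : Fin m → Set V}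
    (h : IsBagDecomposition G T B) : IsTriangleCovered G := by
  rw [isTriangleCovered_iff]
  intro v
  obtain ⟨i, hi⟩ : ∃ i, v ∈ B i := Set.mem_iUnion.1 (h.cover ▸ Set.mem_univ v)
  rcases h.shape with ⟨⟨hA, -⟩, -⟩ | ⟨⟨j, hK, hj⟩, -⟩
  · rcases hA i with h | h
    · exact h.exists_triangle isTriangleCovered_H1 hi
    · exact h.exists_triangle isTriangleCovered_K3 hi
  · by_cases hij : i = j
    · subst hij
      rcases hj with h | h | h
      · exact h.exists_triangle isTriangleCovered_H2 hi
      · exact h.exists_triangle isTriangleCovered_H3 hi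
      · exact h.exists_triangle isTriangleCovered_H4 hi
    · exact (hK i hij).exists_triangle isTriangleCovered_K3 hi

lemma InducedIso.card_H1 {S : Set V} (h : InducedIso G S H1) :
    S.ncard = 5 ∧ (edgesIn G S).ncard = 6 :=
  ⟨by rw [h.ncard_eq, Nat.card_fin], by rw [h.ncard_edgesIn, ncard_edgeSet_H1]⟩

lemma InducedIso.card_K3 {S : Set V} (h : InducedIso G S K3) :
    S.ncard = 3 ∧ (edgesIn G S).ncard = 3 :=
  ⟨by rw [h.ncard_eq, Nat.card_fin], by rw [h.ncard_edgesIn, ncard_edgeSet_K3]⟩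

lemma card_of_inducedIso_H2_or_H3_or_H4 {S : Set V}
    (h : InducedIso G S H2 ∨ InducedIso G S H3 ∨ InducedIso G S H4) :
    S.ncard = 4 ∧ (edgesIn G S).ncard = 5 ∨ S.ncard = 7 ∧ (edgesIn G S).ncard = 9 := by
  rcases h with h | h | h
  · exact .inl ⟨by rw [h.ncard_eq, Nat.card_fin], by rw [h.ncard_edgesIn, ncard_edgeSet_H2]⟩
  · exact .inr ⟨by rw [h.ncard_eq, Nat.card_fin], by rw [h.ncard_edgesIn, ncard_edgeSet_H3]⟩
  · exact .inr ⟨by rw [h.ncard_eq, Nat.card_fin], by rw [h.ncard_edgesIn, ncard_edgeSet_H4]⟩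

/-- The excess of the bag `S`: three times its cyclomatic number minus its order. -/
noncomputable def excess (G : SimpleGraph V) (S : Set V) : ℕ := 3 * (edgesIn G S).ncard + 3 - 4 * S.ncard

/-- The excess is 0 for `K3`, 1 for `H1` and 2 for `H2`, `H3`, `H4`. The first conjunct records that
the truncated subtraction is exact. -/
lemma IsBagDecomposition.exists_excess {B : Fin m → Set V} (h : IsBagDecomposition G T B) :
    (∀ i, 3 * (edgesIn G (B i)).ncard + 3 = 4 * (B i).ncard + excess G (B i)) ∧
      ∑ i, excess G (B i) ≤ 2 := by
  classical
  rcases h.shape with ⟨⟨hA, hle⟩, -⟩ | ⟨⟨j, hK, hj⟩, -⟩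
  · refine ⟨fun i => ?_, ?_⟩
    · unfold excess
      rcases hA i with h | h
      · have := h.card_H1; omega
      · have := h.card_K3; omega
    · calc ∑ i, excess G (B i)
          ≤ ∑ i, if InducedIso G (B i) H1 then 1 else 0 := by
            refine Finset.sum_le_sum fun i _ => ?_
            unfold excess
            split_ifs with hi
            · have := hi.card_H1; omega
            · have := ((hA i).resolve_left hi).card_K3; omega
        _ = {i | InducedIso G (B i) H1}.ncard := by
            rw [Finset.sum_boole, ← Set.ncard_coe_finset]
            simp
        _ ≤ 2 := hle
  · have hj' := card_of_inducedIso_H2_or_H3_or_H4 hj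
    refine ⟨fun i => ?_, ?_⟩
    · unfold excess
      by_cases hij : i = j
      · subst hij; omega
      · have := (hK i hij).card_K3; omega
    · rw [Finset.sum_eq_single j]
      · unfold excess; omega
      · intro i _ hij
        unfold excess
        have := (hK i hij).card_K3; omega
      · simp

variable [Fintype V]

lemma sum_excess {π : V → Fin m}
    (h : ∀ i, 3 * (edgesIn G (π ⁻¹' {i})).ncard + 3 =
      4 * (π ⁻¹' {i}).ncard + excess G (π ⁻¹' {i})) :
    3 * G.edgeSet.ncard + 3 * m =
      4 * Fintype.card V + ∑ i, excess G (π ⁻¹' {i}) + 3 * (crossEdges G π).ncard := by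
  have h1 := Finset.sum_congr (rfl : (Finset.univ : Finset (Fin m)) = _) fun i _ => h i
  rw [Finset.sum_add_distrib, Finset.sum_add_distrib, ← Finset.mul_sum, ← Finset.mul_sum,
    ← card_eq_sum_ncard_fiber, Nat.card_eq_fintype_card, Finset.sum_const, Finset.card_univ,
    Fintype.card_fin, smul_eq_mul] at h1
  have h2 := ncard_edgeSet_eq_sum_add (G := G) π
  omega

lemma IsBagDecomposition.isExtremal {B : Fin m → Set V} (h : IsBagDecomposition G T B)
    (hconn : G.Connected) : IsExtremal G := by
  obtain ⟨π, rfl⟩ := h.exists_fiber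
  have hx := h.ncard_crossEdges
  obtain ⟨h1, h2⟩ := h.exists_excess
  have h3 := sum_excess h1
  exact isExtremal_iff.2 ⟨hconn, h.isTriangleCovered, by omega, by omega⟩

end Decomposition

/-! ### Triangle components as bags, and their quotient. -/

section Bags

variable {V : Type*}

/-- The graph formed by the edges that lie in a triangle. -/
def triangleEdges (G : SimpleGraph V) : SimpleGraph V where
  Adj u v := G.Adj u v ∧ ∃ w, G.Adj u w ∧ G.Adj v w
  symm := ⟨fun _ _ ⟨h, w, hu, hv⟩ => ⟨h.symm, w, hv, hu⟩⟩
  loopless := ⟨fun _ h => h.1.ne rfl⟩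

/-- The simple quotient of `G` by the fibres of `π`. -/
def quotientGraph {ι : Type*} (G : SimpleGraph V) (π : V → ι) : SimpleGraph ι where
  Adj i j := i ≠ j ∧ ∃ u v, π u = i ∧ π v = j ∧ G.Adj u v
  symm := ⟨fun _ _ ⟨h, u, v, hu, hv, huv⟩ => ⟨h.symm, v, u, hv, hu, huv.symm⟩⟩
  loopless := ⟨fun _ h => h.1 rfl⟩

variable {G : SimpleGraph V} {ι : Type*} {π : V → ι}

lemma quotientGraph_connected (hG : G.Connected) (hπ : π.Surjective) :
    (quotientGraph G π).Connected := by
  have key : ∀ u v, G.Reachable u v → (quotientGraph G π).Reachable (π u) (π v) := by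
    rintro u v ⟨p⟩
    induction p with
    | nil => rfl
    | @cons u v w huv p ih =>
      refine SimpleGraph.Reachable.trans ?_ ih
      by_cases h : π u = π v
      · rw [h]
      · exact SimpleGraph.Adj.reachable ⟨h, u, v, rfl, rfl, huv⟩
  have := hG.nonempty.map π
  refine ⟨fun i j => ?_⟩
  obtain ⟨u, rfl⟩ := hπ i
  obtain ⟨v, rfl⟩ := hπ j
  exact key u v (hG.preconnected u v)

lemma image_crossEdges : Sym2.map π '' crossEdges G π = (quotientGraph G π).edgeSet := by
  ext e
  induction e with
  | h i j =>
    constructor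
    · rintro ⟨e, he, hij⟩
      induction e with
      | h u v =>
        rw [mk_mem_crossEdges] at he
        rw [← hij]
        exact ⟨he.2, u, v, rfl, rfl, he.1⟩
    · rintro ⟨hij, u, v, rfl, rfl, huv⟩
      exact ⟨s(u, v), mk_mem_crossEdges.2 ⟨huv, hij⟩, rfl⟩

/-- A set left by no triangle is closed under adjacency in `triangleEdges G`, hence exhausts its
component. -/
lemma triangleConnected_induce_fiber
    (hπ : ∀ u v, π u = π v ↔ (triangleEdges G).Reachable u v) (i : ι) :
    TriangleConnected (G.induce (π ⁻¹' {i})) := by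
  intro S hS huniv
  by_contra hcon
  have hadj : ∀ u v, (triangleEdges G).Adj u v → π u = π v :=
    fun u v h => (hπ u v).2 h.reachable
  have hstep : ∀ u v, (triangleEdges G).Adj u v → u ∈ Subtype.val '' S → v ∈ Subtype.val '' S := by
    rintro _ v huv ⟨⟨u, hu⟩, huS, rfl⟩
    by_contra hv
    obtain ⟨h, w, huw, hvw⟩ := huv
    -- All three sides of a triangle are triangle edges, so its third vertex lies in the same fibre.
    have hv' : π v = i := (hadj u v ⟨h, w, huw, hvw⟩).symm.trans hu
    have hw' : π w = i := (hadj u w ⟨huw, v, h, hvw.symm⟩).symm.trans hu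
    exact hcon ⟨⟨u, hu⟩, huS, ⟨v, hv'⟩, fun hvS => hv ⟨_, hvS, rfl⟩, ⟨w, hw'⟩, h, huw, hvw⟩
  have hreach : ∀ u v, (triangleEdges G).Reachable u v → u ∈ Subtype.val '' S →
      v ∈ Subtype.val '' S := by
    rintro u v ⟨p⟩
    induction p with
    | nil => exact id
    | cons h p ih => exact fun hu => ih (hstep _ _ h hu)
  obtain ⟨⟨u, hu⟩, huS⟩ := hS
  refine huniv (Set.eq_univ_of_forall ?_)
  rintro ⟨v, hv⟩
  obtain ⟨x, hx, rfl⟩ := hreach u v ((hπ u v).1 (hu.trans hv.symm)) ⟨_, huS, rfl⟩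
  exact hx

lemma three_le_ncard_fiber [Finite V] (hcov : IsTriangleCovered G)
    (hπ : ∀ u v, π u = π v ↔ (triangleEdges G).Reachable u v) (v : V) :
    3 ≤ (π ⁻¹' {π v}).ncard := by
  obtain ⟨a, b, hva, hvb, hab⟩ := isTriangleCovered_iff.1 hcov v
  have ha : π a = π v :=
    ((hπ v a).2 (SimpleGraph.Adj.reachable ⟨hva, b, hvb, hab⟩)).symm
  have hb : π b = π v :=
    ((hπ v b).2 (SimpleGraph.Adj.reachable ⟨hvb, a, hva, hab.symm⟩)).symm
  rw [← Set.ncard_eq_three.2 ⟨v, a, b, hva.ne, hvb.ne, hab.ne, rfl⟩]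
  refine Set.ncard_le_ncard ?_
  rintro x (rfl | rfl | rfl)
  exacts [rfl, ha, hb]

/-- If no two cross edges have the same image, then each pair of fibres that is joined by an edge
is joined by exactly one. -/
lemma existsUnique_link (hinj : Set.InjOn (Sym2.map π) (crossEdges G π)) {i j : ι}
    (h : (quotientGraph G π).Adj i j) :
    ∃! e : V × V, e.1 ∈ π ⁻¹' {i} ∧ e.2 ∈ π ⁻¹' {j} ∧ G.Adj e.1 e.2 := by
  obtain ⟨hij, u, v, rfl, rfl, huv⟩ := h
  refine ⟨(u, v), ⟨rfl, rfl, huv⟩, ?_⟩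
  rintro ⟨u', v'⟩ ⟨hu, hv, huv'⟩
  simp only [Set.mem_preimage, Set.mem_singleton_iff] at hu hv huv'
  have := hinj (mk_mem_crossEdges.2 ⟨huv', by rwa [hu, hv]⟩) (mk_mem_crossEdges.2 ⟨huv, hij⟩)
    (by simp [hu, hv])
  rcases Sym2.eq_iff.1 this with ⟨rfl, rfl⟩ | ⟨rfl, rfl⟩
  · rfl
  · exact absurd hv hij

lemma edge_quotientGraph {u v : V} (huv : G.Adj u v) :
    Xor (∃ i, u ∈ π ⁻¹' {i} ∧ v ∈ π ⁻¹' {i})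
      (∃! p : ι × ι, p.1 ≠ p.2 ∧ u ∈ π ⁻¹' {p.1} ∧ v ∈ π ⁻¹' {p.2} ∧
        (quotientGraph G π).Adj p.1 p.2) := by
  by_cases h : π u = π v
  · refine .inl ⟨⟨π v, h, rfl⟩, ?_⟩
    rintro ⟨⟨i, j⟩, ⟨hij, hu, hv, -⟩, -⟩
    exact hij (hu.symm.trans (h.trans hv))
  · refine .inr ⟨⟨(π u, π v), ⟨h, rfl, rfl, h, u, v, rfl, rfl, huv⟩, ?_⟩, ?_⟩
    · rintro ⟨i, j⟩ ⟨-, hu, hv, -⟩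
      exact Prod.ext hu.symm hv.symm
    · rintro ⟨i, hu, hv⟩
      exact h (hu.trans hv.symm)

end Bags

/-! ### From the edge count to a bag decomposition. -/

section Shape

variable {V : Type*} [Fintype V] {G : SimpleGraph V}

/-- With `k` vertices, `2e ≥ 3k - 3` yields `3e + 3 - 4k ≥ (k - 3)/2 ≥ 0`: the subtraction is exact,
and the excess bounds the order. -/
lemma four_mul_ncard_add_excess {S : Set V} (hS : TriangleConnected (G.induce S))
    (h3 : 3 ≤ S.ncard) :
    3 * (edgesIn G S).ncard + 3 = 4 * S.ncard + excess G S ∧ S.ncard ≤ 2 * excess G S + 3 := by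
  have : Nonempty S := (Set.nonempty_of_ncard_ne_zero (by omega)).to_subtype
  have h := hS.three_mul_card_le
  rw [ncard_edgeSet_induce, Nat.card_coe_set_eq] at h
  unfold excess
  omega

/-- For excess `x` and order `k`, `3e + 3 = 4k + x` makes `k + x` divisible by 3, while `3 ≤ k ≤ 2x
+ 3`. This leaves `k = 3` for `x = 0`, `k = 5` for `x = 1`, and `k = 4` or `k = 7` for `x = 2`. -/
lemma inducedIso_of_excess {S : Set V} (hS : TriangleConnected (G.induce S))
    (h3 : 3 ≤ S.ncard) :
    (excess G S = 0 → InducedIso G S K3) ∧ (excess G S = 1 → InducedIso G S H1) ∧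
      (excess G S = 2 → InducedIso G S H2 ∨ InducedIso G S H3 ∨ InducedIso G S H4) := by
  have : Nonempty S := (Set.nonempty_of_ncard_ne_zero (by omega)).to_subtype
  obtain ⟨h1, h2⟩ := four_mul_ncard_add_excess hS h3
  have hn := Nat.card_coe_set_eq S
  have he := ncard_edgeSet_induce (G := G) S
  refine ⟨fun h => ?_, fun h => ?_, fun h => ?_⟩
  · exact nonempty_iso_K3 hS (by omega) (by omega)
  · exact nonempty_iso_H1 hS (by omega) (by omega)
  · obtain h4 | h7 : S.ncard = 4 ∨ S.ncard = 7 := by omega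
    · exact .inl (nonempty_iso_H2 hS (by omega) (by omega))
    · exact .inr (nonempty_iso_H3_or_H4 hS (by omega) (by omega))

lemma shape_of_sum_excess_le {m : ℕ} {B : Fin m → Set V}
    (hB : ∀ i, TriangleConnected (G.induce (B i))) (h3 : ∀ i, 3 ≤ (B i).ncard)
    (hsum : ∑ i, excess G (B i) ≤ 2) :
    Xor
      ((∀ i, InducedIso G (B i) H1 ∨ InducedIso G (B i) K3) ∧
        {i | InducedIso G (B i) H1}.ncard ≤ 2)
      (∃ j, (∀ i, i ≠ j → InducedIso G (B i) K3) ∧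
        (InducedIso G (B j) H2 ∨ InducedIso G (B j) H3 ∨ InducedIso G (B j) H4)) := by
  classical
  have hiso := fun i => inducedIso_of_excess (hB i) (h3 i)
  have hnot : ∀ j, (InducedIso G (B j) H2 ∨ InducedIso G (B j) H3 ∨ InducedIso G (B j) H4) →
      ¬ (InducedIso G (B j) H1 ∨ InducedIso G (B j) K3) := by
    rintro j hj (h | h)
    · have := card_of_inducedIso_H2_or_H3_or_H4 hj
      have := h.card_H1
      omega
    · have := card_of_inducedIso_H2_or_H3_or_H4 hj
      have := h.card_K3
      omega
  by_cases h2 : ∃ j, excess G (B j) = 2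
  · obtain ⟨j, hj⟩ := h2
    refine .inr ⟨⟨j, fun i hij => (hiso i).1 ?_, (hiso j).2.2 hj⟩,
      fun hA => hnot j ((hiso j).2.2 hj) (hA.1 j)⟩
    -- Bag `j` already uses up the total of 2, so every other excess vanishes.
    have := Finset.sum_le_sum_of_subset (f := fun i => excess G (B i))
      (Finset.subset_univ {i, j})
    rw [Finset.sum_pair hij] at this
    omega
  · push Not at h2
    refine .inl ⟨⟨fun i => ?_, ?_⟩, ?_⟩
    · have hle := Finset.single_le_sum (f := fun i => excess G (B i)) (fun i _ => Nat.zero_le _)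
        (Finset.mem_univ i)
      have := h2 i
      obtain h | h : excess G (B i) = 0 ∨ excess G (B i) = 1 := by
        omega
      · exact .inr ((hiso i).1 h)
      · exact .inl ((hiso i).2.1 h)
    · calc {i | InducedIso G (B i) H1}.ncard
          = ∑ i, if InducedIso G (B i) H1 then 1 else 0 := by
            rw [Finset.sum_boole, ← Set.ncard_coe_finset]
            simp
        _ ≤ ∑ i, excess G (B i) := by
            refine Finset.sum_le_sum fun i _ => ?_
            split_ifs with hi
            · have := hi.card_H1
              unfold excess
              omega
            · exact Nat.zero_le _
        _ ≤ 2 := hsum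
    · rintro ⟨j, -, hj⟩
      have := card_of_inducedIso_H2_or_H3_or_H4 hj
      have := h2 j
      unfold excess at this
      omega

lemma IsExtremal.exists_isBagDecomposition (hG : IsExtremal G) :
    ∃ (m : ℕ) (T : SimpleGraph (Fin m)) (B : Fin m → Set V), IsBagDecomposition G T B := by
  classical
  obtain ⟨hconn, hcov, -, hle⟩ := isExtremal_iff.1 hG
  let e := Fintype.equivFin (triangleEdges G).ConnectedComponent
  let π : V → Fin (Fintype.card (triangleEdges G).ConnectedComponent) :=
    fun v => e ((triangleEdges G).connectedComponentMk v)
  have hπ : ∀ u v, π u = π v ↔ (triangleEdges G).Reachable u v := fun u v => by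
    rw [e.injective.eq_iff, SimpleGraph.ConnectedComponent.eq]
  have hsurj : π.Surjective :=
    e.surjective.comp fun c => c.exists_rep
  have hB := fun i => triangleConnected_induce_fiber hπ i
  have h3 : ∀ i, 3 ≤ (π ⁻¹' {i}).ncard := fun i => by
    obtain ⟨v, rfl⟩ := hsurj i
    exact three_le_ncard_fiber hcov hπ v
  have hsum := sum_excess fun i => (four_mul_ncard_add_excess (hB i) (h3 i)).1
  have hTconn := quotientGraph_connected hconn hsurj
  have hT := hTconn.card_vert_le_card_edgeSet_add_one
  have himg := Set.ncard_image_le (f := Sym2.map π) (s := crossEdges G π)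
  rw [image_crossEdges] at himg
  rw [Nat.card_fin, Nat.card_coe_set_eq] at hT
  refine ⟨_, quotientGraph G π, fun i => π ⁻¹' {i}, ?_, ?_, ?_, ?_, ?_, ?_⟩
  · rw [SimpleGraph.isTree_iff_connected_and_card, Nat.card_fin, Nat.card_coe_set_eq]
    -- `hsum` and `hle` give `∑ excess + 3c ≤ 3m - 1` for `c` cross edges, so `c ≤ m - 1`. The
    -- connected quotient has at least `m - 1` edges and at most `c`, so equality holds throughout.
    exact ⟨hTconn, by omega⟩
  · exact fun i j hij => Set.disjoint_left.2 fun v hi hj => hij (hi.symm.trans hj)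
  · ext v
    simp
  · exact shape_of_sum_excess_le hB h3 (by omega)
  · exact fun u v => edge_quotientGraph
  -- The quotient has as many edges as there are cross edges, so no two cross edges join the same
  -- pair of bags.
  · refine fun i j => existsUnique_link (Set.injOn_of_ncard_image_eq ?_)
    rw [image_crossEdges]
    omega

end Shape

end TriangleCovered

theorem mainTheorem2 {V : Type*} [Fintype V] (G : SimpleGraph V) (n : ℕ)
    (hcard : Fintype.card V = n) (hn : 8 ≤ n) (hconn : G.Connected) :
    TriangleCovered.IsExtremal G ↔ TriangleCovered.MemGTree n G :=
  ⟨fun h => ⟨hcard, h.exists_isBagDecomposition⟩,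
    fun ⟨_, _, _, _, h⟩ => h.isExtremal hconn⟩
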